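/- Let $M$ be a finite von Neumann algebra on a complex Hilbert space $H$, that is, a von Neumann algebra $M\subseteq B(H)$ together with a faithful normal tracial state $\tau$ on $M$. Let $S=\{s_i\}_{i\in I}\subset M$ be a standard free semicircular system with respect to $\tau$, where $I$ is an arbitrary index set. This means: (a) each $s_i$ is self-adjoint and has the standard semicircle distribution, $$\tau(s_i^k)=\frac1{2\pi}\int_{-2}^{2}t^k\sqrt{4-t^2}\,dt\qquad(k\ge 0,\ i\in I);$$ (b) the family is free: writing $A_i$ for the unital $*$-subalgebra generated by $s_i$, one has $\tau(x_1x_2\cdots x_k)=0$ whenever $k\ge1$, $x_j\in A_{i(j)}$, $\tau(x_j)=0$ for $1\le j\le k$, and $i(j)\neq i(j+1)$ for $1\le j<k$. Then for every noncommutative polynomial $P\in\mathbb C\langle X_i: i\in I\rangle$, $$\|P(S)\|_{2}\;\le\;\|P(S)\|_{\infty}\;\le\;(\deg P+1)^{3/2}\,\|P(S)\|_{2}.$$ Here $P(S)\in M$ is the evaluation of $P$ at $X_i=s_i$, $\|x\|_2=\tau(x^*x)^{1/2}$, $\|x\|_\infty$ is the operator norm of $x$, and $\deg P$ is the largest length of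 a word that occurs in $P$ with nonzero coefficient (with $\deg 0=0$). -/

import Mathlib

open scoped ComplexOrder

namespace FreeProb

section NoncommutativeProbability

variable {A : Type*} [Ring A] [StarRing A] [Algebra ℂ A] [StarModule ℂ A]

/-- A state on a unital `*`-algebra: a linear functional that is unital and positive. -/
structure IsState (φ : A →ₗ[ℂ] ℂ) : Prop where
  map_one : φ 1 = 1
  nonneg : ∀ a : A, 0 ≤ φ (star a * a)

/-- Free independence of a family of unital `*`-subalgebras: products of centered elements whose
neighbouring factors come from different subalgebras are centered. The words have length
`k + 1 ≥ 1`. -/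
def AreFree {I : Type*} (φ : A →ₗ[ℂ] ℂ) (B : I → StarSubalgebra ℂ A) : Prop :=
  ∀ (k : ℕ) (r : Fin (k + 1) → I) (x : Fin (k + 1) → A),
    (∀ j : Fin k, r j.castSucc ≠ r j.succ) →
    (∀ j, x j ∈ B (r j)) → (∀ j, φ (x j) = 0) →
    φ (List.ofFn x).prod = 0

/-- A family of random variables is free if the unital `*`-subalgebras that its members generate
are free. -/
def IsFreeFamily {I : Type*} (φ : A →ₗ[ℂ] ℂ) (x : I → A) : Prop :=
  AreFree φ fun i => StarAlgebra.adjoin ℂ {x i}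

/-- The `k`-th moment of Wigner's standard semicircle law on `[-2, 2]`. -/
noncomputable def semicircleMoment (k : ℕ) : ℝ :=
  1 / (2 * Real.pi) * ∫ t in (-2 : ℝ)..2, t ^ k * Real.sqrt (4 - t ^ 2)

/-- A (standard) free semicircular system: a free family of self-adjoint elements, each of them
distributed according to the standard semicircle law. -/
structure IsFreeSemicircularSystem {I : Type*} (φ : A →ₗ[ℂ] ℂ) (s : I → A) : Prop where
  free : IsFreeFamily φ s
  selfAdjoint : ∀ i, IsSelfAdjoint (s i)
  moments : ∀ i k, φ (s i ^ k) = (semicircleMoment k : ℂ)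

/-- The `L²`-norm `τ(x* x)^{1/2}` attached to a state `τ`. -/
noncomputable def normTwo (τ : A →ₗ[ℂ] ℂ) (x : A) : ℝ :=
  Real.sqrt (τ (star x * x)).re

end NoncommutativeProbability

/-- `(M, τ)` is a finite von Neumann algebra with its trace: `τ` is a faithful normal tracial state
on `M`. Normality is the preservation of suprema of directed sets of positive elements; the order
on `M` is the operator order. -/
structure IsFaithfulNormalTracialState {H : Type*} [NormedAddCommGroup H] [InnerProductSpace ℂ H]
    [CompleteSpace H] (M : VonNeumannAlgebra H) (τ : M.toStarSubalgebra →ₗ[ℂ] ℂ) : Prop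
    extends IsState τ where
  tracial : ∀ a b, τ (a * b) = τ (b * a)
  faithful : ∀ a, τ (star a * a) = 0 → a = 0
  normal : ∀ (D : Set M.toStarSubalgebra) (a : M.toStarSubalgebra),
    D.Nonempty → DirectedOn (· ≤ ·) D → (∀ x ∈ D, 0 ≤ x) → IsLUB D a →
    IsLUB ((fun x => (τ x).re) '' D) (τ a).re

/-- The degree of a noncommutative polynomial: the largest length of a word that occurs in it with
a nonzero coefficient (and `0` for the zero polynomial). -/
noncomputable def ncDegree {I : Type*} (P : FreeAlgebra ℂ I) : ℕ :=
  (FreeAlgebra.equivMonoidAlgebraFreeMonoid P).coeff.support.sup FreeMonoid.length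

end FreeProb

/-! The free Wick words `wick s v` are orthonormal for `φ (star x * y)`
(`IsFreeSemicircularSystem.map_star_wick_mul_wick`), and those of length at most `n` span a space
containing every polynomial of degree at most `n`. A product of two Wick words is their
concatenation plus, if the letters at the seam agree, the product of the two shortened words. For
fixed left length `p` the concatenation terms are orthonormal; Cauchy–Schwarz over the contracted
letter bounds the rest by the case `p - 1`. Each number of contracted letters thus costs one factor
`‖x‖₂ ‖y‖₂`, giving `p + 1` in total (`norm_map_mul_le_of_homogeneous`), and Cauchy–Schwarz over `p
≤ n` gives `‖x y‖₂ ≤ K ‖y‖₂` with `K = (n + 1)^(3/2) ‖x‖₂` for polynomials `y`.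

No density argument is needed to reach the operator norm: iteration bounds the even moments of `star
x * x` by powers of `K ^ 2`, and for a faithful state such growth bounds the norm
(`IsState.norm_le_of_moments_le`). The lower bound is positivity of the state on `‖x‖² - star x *
x`. -/

namespace FreeProb

/-! ### Free Wick words and their product rules. -/

section Wick

variable {A I : Type*} [Ring A]

open Classical in
/-- The free Wick word attached to a list of indices: the products of Chebyshev polynomials
of the second kind given by the annihilation-creation recursion. -/
noncomputable def wick (s : I → A) : List I → A
  | [] => 1
  | [i] => s i
  | i :: j :: w => s i * wick s (j :: w) - if i = j then wick s w else 0

variable (s : I → A)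

@[simp] theorem wick_nil : wick s [] = 1 := by simp [wick]

@[simp] theorem wick_singleton (i : I) : wick s [i] = s i := by simp [wick]

theorem mul_wick_cons_self (i : I) (w : List I) :
    s i * wick s (i :: w) = wick s (i :: i :: w) + wick s w := by
  simp [wick]

theorem mul_wick_cons_of_ne {i j : I} (h : i ≠ j) (w : List I) :
    s i * wick s (j :: w) = wick s (i :: j :: w) := by
  simp [wick, h]

/-- Right creation on the left factor, when the letters annihilate. -/
theorem wick_append_singleton_mul_cons_self (i : I) (w : List I) (v : List I) :
    wick s (v ++ [i]) * wick s (i :: w) = wick s (v ++ i :: i :: w) + wick s v * wick s w := by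
  -- The recursion for `wick` reads two letters at the left end, away from the seam, so it commutes
  -- with multiplication on the right.
  induction v using List.twoStepInduction with
  | nil => simp [mul_wick_cons_self]
  | singleton j =>
    by_cases h : j = i
    · subst h
      have h1 : wick s [j, j] = s j * s j - 1 := by simp [wick]
      have h2 := mul_wick_cons_self s j (j :: w)
      have h3 := mul_wick_cons_self s j w
      simp only [List.cons_append, List.nil_append, h1, wick_singleton, sub_mul, mul_assoc, one_mul,
        h3, mul_add, h2]
      abel
    · have h1 : wick s [j, i] = s j * s i := by simp [wick, h]
      simp only [List.cons_append, List.nil_append, h1, wick_singleton, mul_assoc,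
        mul_wick_cons_self, mul_add, mul_wick_cons_of_ne s h]
  | cons_cons j l v ih1 ih2 =>
    have h2 := ih2 l
    simp only [List.cons_append] at h2 ⊢
    by_cases h : j = l
    · subst h
      have e : ∀ x, wick s (j :: j :: x) = s j * wick s (j :: x) - wick s x := fun x => by
        simp [wick]
      simp only [e, sub_mul, mul_assoc, h2, ih1, mul_add]
      abel
    · have e : ∀ x, wick s (j :: l :: x) = s j * wick s (l :: x) := fun x => by
        simp [wick, h]
      simp only [e, mul_assoc, h2, mul_add]

/-- Right creation on the left factor, when the letters do not annihilate. -/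
theorem wick_append_singleton_mul_of_head {i : I} {w : List I} (hw : ∀ j ∈ w.head?, i ≠ j)
    (v : List I) : wick s (v ++ [i]) * wick s w = wick s (v ++ i :: w) := by
  have key : s i * wick s w = wick s (i :: w) := by
    cases w with
    | nil => simp
    | cons j w => exact mul_wick_cons_of_ne s (hw j (by simp)) w
  induction v using List.twoStepInduction with
  | nil => simpa using key
  | singleton j =>
    by_cases h : j = i
    · subst h
      have h1 : wick s [j, j] = s j * s j - 1 := by simp [wick]
      simp only [List.cons_append, List.nil_append, h1, sub_mul, mul_assoc, one_mul,
        key, mul_wick_cons_self]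
      abel
    · have h1 : wick s [j, i] = s j * s i := by simp [wick, h]
      simp only [List.cons_append, List.nil_append, h1, mul_assoc, key, mul_wick_cons_of_ne s h]
  | cons_cons j l v ih1 ih2 =>
    have h2 := ih2 l
    simp only [List.cons_append] at h2 ⊢
    by_cases h : j = l
    · subst h
      have e : ∀ x, wick s (j :: j :: x) = s j * wick s (j :: x) - wick s x := fun x => by
        simp [wick]
      simp only [e, sub_mul, mul_assoc, h2, ih1]
    · have e : ∀ x, wick s (j :: l :: x) = s j * wick s (l :: x) := fun x => by
        simp [wick, h]
      simp only [e, mul_assoc, h2]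

/-- On equal letters the Wick recursion is the Chebyshev recursion `S (k + 2) = X * S (k + 1) - S
k`. This links Wick words to freeness, since each block of equal letters becomes a polynomial in one
variable. -/
theorem wick_replicate_append [Algebra ℂ A] {i : I} {w : List I} (hw : ∀ j ∈ w.head?, i ≠ j)
    (k : ℕ) : wick s (List.replicate k i ++ w) =
      Polynomial.aeval (s i) (Polynomial.Chebyshev.S ℂ k) * wick s w := by
  induction k using Nat.twoStepInduction with
  | zero => simp
  | one =>
    cases w with
    | nil => simp
    | cons j w => simpa using (mul_wick_cons_of_ne s (hw j (by simp)) w).symm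
  | more k h1 h2 =>
    have h := mul_wick_cons_self s i (List.replicate k i ++ w)
    rw [List.replicate_succ, List.cons_append] at h2
    rw [List.replicate_succ, List.replicate_succ, List.cons_append, List.cons_append,
      ← sub_eq_iff_eq_add.2 h, h2, h1]
    push_cast
    rw [Polynomial.Chebyshev.S_add_two]
    simp [sub_mul, mul_assoc]

/-- The adjoint turns the left recursion into a right one, which the product rules at the seam also
provide. -/
theorem star_wick [StarRing A] (hs : ∀ i, IsSelfAdjoint (s i)) (w : List I) :
    star (wick s w) = wick s w.reverse := by
  induction w using List.twoStepInduction with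
  | nil => simp
  | singleton i => simpa using (hs i).star_eq
  | cons_cons i j w ih1 ih2 =>
    by_cases h : i = j
    · subst h
      have h1 := wick_append_singleton_mul_cons_self s i [] w.reverse
      have h2 : wick s (i :: i :: w) = s i * wick s (i :: w) - wick s w := by simp [wick]
      rw [h2, star_sub, star_mul, ih2, ih1, (hs i).star_eq]
      simp only [wick_singleton, wick_nil, mul_one] at h1
      simp [h1]
    · have h1 := wick_append_singleton_mul_of_head s (i := j) (w := [i])
        (by simpa using Ne.symm h) w.reverse
      have h2 : wick s (i :: j :: w) = s i * wick s (j :: w) := by simp [wick, h]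
      rw [h2, star_mul, ih2, (hs i).star_eq]
      simp only [wick_singleton] at h1
      simp [h1]

end Wick

/-! ### The `L²` bound for left multiplication. -/

section Haagerup

/-- The squared `ℓ²`-norm of a finitely supported function. -/
noncomputable def normSqSum {ι : Type*} (ξ : ι →₀ ℂ) : ℝ := ξ.sum fun _ c => ‖c‖ ^ 2

theorem normSqSum_nonneg {ι : Type*} (ξ : ι →₀ ℂ) : 0 ≤ normSqSum ξ :=
  Finset.sum_nonneg fun _ _ => by positivity

section Orthonormal

variable {ι E : Type*} [SeminormedAddCommGroup E] [InnerProductSpace ℂ E]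

theorem norm_sum_smul_sq [DecidableEq ι] {S : Finset ι} {e : ι → E} (c : ι → ℂ)
    (h : ∀ x ∈ S, ∀ y ∈ S, inner ℂ (e x) (e y) = if x = y then 1 else 0) :
    ‖∑ x ∈ S, c x • e x‖ ^ 2 = ∑ x ∈ S, ‖c x‖ ^ 2 := by
  have key : inner ℂ (∑ x ∈ S, c x • e x) (∑ x ∈ S, c x • e x) =
      ((∑ x ∈ S, ‖c x‖ ^ 2 : ℝ) : ℂ) := by
    rw [sum_inner, Complex.ofReal_sum]
    refine Finset.sum_congr rfl fun x hx => ?_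
    rw [inner_sum, Finset.sum_eq_single_of_mem x hx fun y hy hyx => ?_]
    · rw [inner_smul_left, inner_smul_right, h x hx x hx, if_pos rfl, mul_one, Complex.conj_mul']
      push_cast
      rfl
    · rw [inner_smul_left, inner_smul_right, h x hx y hy, if_neg hyx.symm]
      simp
  have := congrArg RCLike.re key
  rw [inner_self_eq_norm_sq] at this
  exact this

theorem norm_linearCombination_sq {e : ι → E} (he : Orthonormal ℂ e) (ξ : ι →₀ ℂ) :
    ‖Finsupp.linearCombination ℂ e ξ‖ ^ 2 = normSqSum ξ := by
  classical
  rw [Finsupp.linearCombination_apply]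
  exact norm_sum_smul_sq _ fun x _ y _ => orthonormal_iff_ite.1 he x y

end Orthonormal

variable {I : Type*}

/-- The finitely supported function `u ↦ ξ (i :: u)`. -/
noncomputable def annihilate (i : I) (ξ : List I →₀ ℂ) : List I →₀ ℂ :=
  ξ.comapDomain (List.cons i) List.cons_injective.injOn

@[simp] theorem annihilate_apply (i : I) (ξ : List I →₀ ℂ) (u : List I) :
    annihilate i ξ u = ξ (i :: u) := rfl

/-- The map `(i, u) ↦ i :: u` is injective, so the left side sums `‖ξ v‖²` over part of the support;
the empty word is lost. -/
theorem sum_normSqSum_annihilate_le (F : Finset I) (ξ : List I →₀ ℂ) :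
    ∑ i ∈ F, normSqSum (annihilate i ξ) ≤ normSqSum ξ := by
  classical
  simp only [normSqSum, Finsupp.sum, annihilate_apply]
  rw [Finset.sum_sigma']
  rw [← Finset.sum_image (s := F.sigma fun i => (annihilate i ξ).support)
    (g := fun x : (_ : I) × List I => x.1 :: x.2) (f := fun v => ‖ξ v‖ ^ 2)]
  · refine Finset.sum_le_sum_of_subset_of_nonneg ?_ fun _ _ _ => by positivity
    intro v hv
    simp only [Finset.mem_image, Finset.mem_sigma, Finsupp.mem_support_iff, annihilate_apply] at hv
    obtain ⟨x, ⟨-, hx⟩, rfl⟩ := hv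
    simpa using hx
  · rintro ⟨i, u⟩ - ⟨j, v⟩ - h
    simp only [List.cons.injEq] at h
    obtain ⟨rfl, rfl⟩ := h
    rfl

open Classical in
/-- Apply `g` to the tail of a list whose head is `i`; zero on other lists. -/
noncomputable def onTail {X : Type*} [Zero X] (g : List I → X) (i : I) : List I → X
  | [] => 0
  | k :: u => if k = i then g u else 0

theorem linearCombination_annihilate {X : Type*} [AddCommGroup X] [Module ℂ X] (g : List I → X)
    (i : I) (ξ : List I →₀ ℂ) :
    Finsupp.linearCombination ℂ g (annihilate i ξ) =
      ∑ u ∈ ξ.support, ξ u • onTail g i u := by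
  have h : ∀ ξ : List I →₀ ℂ, ∑ u ∈ ξ.support, ξ u • onTail g i u =
    Finsupp.linearCombination ℂ (onTail g i) ξ := fun ξ => rfl
  rw [h]
  induction ξ using Finsupp.induction_linear with
  | zero =>
    have : annihilate i (0 : List I →₀ ℂ) = 0 := by ext; simp
    simp [this]
  | add ξ η h1 h2 =>
    have : annihilate i (ξ + η) = annihilate i ξ + annihilate i η := by ext; simp
    rw [this, map_add, map_add, h1, h2]
  | single v c =>
    classical
    have : annihilate i (Finsupp.single v c) = onTail (fun u => Finsupp.single u c) i v := by
      ext u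
      cases v with
      | nil => simp [onTail]
      | cons k v =>
        by_cases hk : k = i
        · subst hk
          simp [onTail, Finsupp.single_apply]
        · simp [onTail, hk]
    rw [this, Finsupp.linearCombination_single]
    cases v with
    | nil => simp [onTail]
    | cons k v =>
      by_cases hk : k = i <;> simp [onTail, hk]

/-- With the left word reversed, both seam letters are heads of lists, and at most one `i`
contributes. Only one letter is contracted; further contractions stay inside the smaller product. -/
theorem wick_reverse_mul_wick {A : Type*} [Ring A] (s : I → A) {F : Finset I} {u : List I}
    (hu : ∀ i ∈ u.head?, i ∈ F)
    (w : List I) : wick s u.reverse * wick s w = wick s (u.reverse ++ w) +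
      ∑ i ∈ F, onTail (fun u => wick s u.reverse) i u * onTail (wick s) i w := by
  cases u with
  | nil => simp [onTail]
  | cons k u =>
    have hk : k ∈ F := hu k (by simp)
    rw [Finset.sum_eq_single_of_mem k hk fun i _ hi => by simp [onTail, hi.symm], List.reverse_cons]
    by_cases h : ∀ j ∈ w.head?, k ≠ j
    · rw [wick_append_singleton_mul_of_head s h]
      cases w with
      | nil => simp [onTail]
      | cons j w =>
        have : j ≠ k := (h j (by simp)).symm
        simp [onTail, this]
    · cases w with
      | nil => simp at h
      | cons j w =>
        obtain rfl : k = j := by simpa using h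
        rw [wick_append_singleton_mul_cons_self]
        simp [onTail]

variable {A : Type*} [Ring A] [Algebra ℂ A] (s : I → A)

theorem linearCombination_wick_mul {F : Finset I} {ξ : List I →₀ ℂ}
    (hF : ∀ u ∈ ξ.support, ∀ i ∈ u.head?, i ∈ F) (η : List I →₀ ℂ) :
    Finsupp.linearCombination ℂ (fun u => wick s u.reverse) ξ *
        Finsupp.linearCombination ℂ (wick s) η =
      (∑ x ∈ ξ.support ×ˢ η.support, (ξ x.1 * η x.2) • wick s (x.1.reverse ++ x.2)) +
      ∑ i ∈ F, Finsupp.linearCombination ℂ (fun u => wick s u.reverse) (annihilate i ξ) *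
        Finsupp.linearCombination ℂ (wick s) (annihilate i η) := by
  simp only [linearCombination_annihilate]
  simp only [Finsupp.linearCombination_apply, Finsupp.sum, Finset.sum_mul_sum,
    ← Finset.sum_product' ξ.support η.support]
  rw [Finset.sum_comm, ← Finset.sum_add_distrib]
  refine Finset.sum_congr rfl fun x hx => ?_
  rw [Finset.mem_product] at hx
  simp only [smul_mul_smul_comm]
  rw [wick_reverse_mul_wick s (hF x.1 hx.1), smul_add, Finset.smul_sum]

variable {E : Type*} [SeminormedAddCommGroup E] [InnerProductSpace ℂ E] {j : A →ₗ[ℂ] E} {s}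

theorem norm_map_linearCombination (hj : Orthonormal ℂ fun v => j (wick s v))
    (η : List I →₀ ℂ) : ‖j (Finsupp.linearCombination ℂ (wick s) η)‖ = √(normSqSum η) := by
  rw [Finsupp.apply_linearCombination, ← norm_linearCombination_sq hj, Real.sqrt_sq (norm_nonneg _)]
  rfl

theorem norm_map_linearCombination_reverse (hj : Orthonormal ℂ fun v => j (wick s v))
    (ξ : List I →₀ ℂ) :
    ‖j (Finsupp.linearCombination ℂ (fun u => wick s u.reverse) ξ)‖ = √(normSqSum ξ) := by
  rw [Finsupp.apply_linearCombination,
    ← norm_linearCombination_sq (hj.comp List.reverse List.reverse_injective),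
    Real.sqrt_sq (norm_nonneg _)]
  rfl

/-- Homogeneity matters here: once the left length is fixed, a concatenation determines both of its
parts, so distinct pairs give orthogonal terms. -/
theorem norm_map_creation (hj : Orthonormal ℂ fun v => j (wick s v)) {p : ℕ}
    (ξ η : List I →₀ ℂ) (hξ : ∀ u ∈ ξ.support, u.length = p) :
    ‖j (∑ x ∈ ξ.support ×ˢ η.support,
      (ξ x.1 * η x.2) • wick s (x.1.reverse ++ x.2))‖ = √(normSqSum ξ) * √(normSqSum η) := by
  classical
  rw [← Real.sqrt_mul (normSqSum_nonneg _), ← Real.sqrt_sq (norm_nonneg (j _))]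
  congr 1
  simp only [map_sum, map_smul]
  rw [norm_sum_smul_sq]
  · simp only [normSqSum, Finsupp.sum, Finset.sum_mul_sum, norm_mul, mul_pow,
      Finset.sum_product]
  · intro x hx y hy
    rw [orthonormal_iff_ite.1 hj]
    rw [Finset.mem_product] at hx hy
    refine if_congr ⟨fun h => ?_, fun h => by rw [h]⟩ rfl rfl
    have := List.append_inj h (by simp [hξ _ hx.1, hξ _ hy.1])
    exact Prod.ext (List.reverse_injective this.1) this.2

/-- Haagerup's inequality for homogeneous elements. -/
theorem norm_map_mul_le_of_homogeneous (hj : Orthonormal ℂ fun v => j (wick s v)) (p : ℕ)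
    (ξ η : List I →₀ ℂ) (hξ : ∀ u ∈ ξ.support, u.length = p) :
    ‖j (Finsupp.linearCombination ℂ (fun u => wick s u.reverse) ξ *
        Finsupp.linearCombination ℂ (wick s) η)‖ ≤
      (p + 1) * (√(normSqSum ξ) * √(normSqSum η)) := by
  classical
  induction p generalizing ξ η with
  | zero =>
    rw [linearCombination_wick_mul s (F := ∅), Finset.sum_empty, add_zero]
    · rw [norm_map_creation hj ξ η hξ]
      simp
    · intro u hu i hi
      rw [List.length_eq_zero_iff.1 (hξ u hu)] at hi
      simp at hi
  | succ p ih =>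
    -- `I` may be infinite, but only finitely many letters begin words of `ξ`.
    let F : Finset I := ξ.support.biUnion fun u => u.head?.toFinset
    have hF : ∀ u ∈ ξ.support, ∀ i ∈ u.head?, i ∈ F := fun u hu i hi =>
      Finset.mem_biUnion.2 ⟨u, hu, Option.mem_toFinset.2 hi⟩
    have hstep : ∀ i ∈ F, ‖j (Finsupp.linearCombination ℂ (fun u => wick s u.reverse)
        (annihilate i ξ) * Finsupp.linearCombination ℂ (wick s) (annihilate i η))‖ ≤
        (p + 1) * (√(normSqSum (annihilate i ξ)) * √(normSqSum (annihilate i η))) := fun i _ => by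
      have hdeg : ∀ u ∈ (annihilate i ξ).support, u.length = p := fun u hu => by
        have := hξ (i :: u) (by simpa using hu)
        simpa using this
      exact ih _ _ hdeg
    rw [linearCombination_wick_mul s hF, map_add, map_sum j _ F]
    calc _ ≤ _ := (norm_add_le _ _).trans (add_le_add (norm_map_creation hj ξ η hξ).le
          ((norm_sum_le _ _).trans (Finset.sum_le_sum hstep)))
      _ ≤ √(normSqSum ξ) * √(normSqSum η) + (p + 1) * (√(normSqSum ξ) * √(normSqSum η)) := by
        rw [← Finset.mul_sum]
        gcongr
        -- Cauchy–Schwarz over the contracted letter.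
        refine (Real.sum_sqrt_mul_sqrt_le _ (fun _ => normSqSum_nonneg _)
          fun _ => normSqSum_nonneg _).trans ?_
        gcongr <;> exact sum_normSqSum_annihilate_le F _
      _ = ((p + 1 : ℕ) + 1) * (√(normSqSum ξ) * √(normSqSum η)) := by push_cast; ring

/-- The elements spanned by the free Wick words of length at most `n`. -/
def wickSpan (s : I → A) (n : ℕ) : Submodule ℂ A :=
  Submodule.span ℂ (wick s '' {v | v.length ≤ n})

theorem wick_mem_wickSpan {v : List I} {n : ℕ} (hv : v.length ≤ n) : wick s v ∈ wickSpan s n :=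
  Submodule.subset_span ⟨v, hv, rfl⟩

theorem wickSpan_mono : Monotone (wickSpan s) := fun _ _ h =>
  Submodule.span_mono (Set.image_mono fun _ hv => le_trans hv h)

theorem mul_mem_wickSpan (i : I) {n : ℕ} {x : A} (hx : x ∈ wickSpan s n) :
    s i * x ∈ wickSpan s (n + 1) := by
  induction hx using Submodule.span_induction with
  | zero => simp
  | add x y _ _ hx hy => rw [mul_add]; exact add_mem hx hy
  | smul c x _ hx => rw [mul_smul_comm]; exact Submodule.smul_mem _ c hx
  | mem x hx =>
    obtain ⟨v, hv, rfl⟩ := hx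
    have hv : v.length ≤ n := hv
    cases v with
    | nil => simpa using wick_mem_wickSpan (s := s) (v := [i]) (by simp)
    | cons k v =>
      by_cases h : i = k
      · subst h
        rw [mul_wick_cons_self]
        simp only [List.length_cons] at hv
        exact add_mem (wick_mem_wickSpan (by simp; omega)) (wick_mem_wickSpan (by omega))
      · rw [mul_wick_cons_of_ne s h]
        exact wick_mem_wickSpan (by simpa using hv)

theorem prod_map_mem_wickSpan (w : List I) : (w.map s).prod ∈ wickSpan s w.length := by
  induction w with
  | nil => simpa using wick_mem_wickSpan (s := s) (v := []) le_rfl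
  | cons i w ih => simpa using mul_mem_wickSpan i ih

/-- Multiplying a Wick word by a letter yields words at most one letter longer, so a monomial stays
within its own degree. -/
theorem lift_mem_wickSpan (P : FreeAlgebra ℂ I) :
    FreeAlgebra.lift ℂ s P ∈ wickSpan s (ncDegree P) := by
  have h : FreeAlgebra.lift ℂ s = (MonoidAlgebra.lift ℂ A _ (FreeMonoid.lift s)).comp
      FreeAlgebra.equivMonoidAlgebraFreeMonoid.toAlgHom := by
    ext i
    simp [FreeAlgebra.equivMonoidAlgebraFreeMonoid]
  rw [h, AlgHom.comp_apply, MonoidAlgebra.lift_apply]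
  refine Submodule.sum_mem _ fun w hw => Submodule.smul_mem _ _ ?_
  rw [FreeMonoid.lift_apply]
  exact wickSpan_mono (Finset.le_sup (f := FreeMonoid.length) hw) (prod_map_mem_wickSpan w.toList)

/-- Haagerup's inequality for elements of degree at most `n`. -/
theorem norm_map_mul_le (hj : Orthonormal ℂ fun v => j (wick s v)) {n : ℕ} {x : A}
    (hx : x ∈ wickSpan s n) {m : ℕ} {y : A} (hy : y ∈ wickSpan s m) :
    ‖j (x * y)‖ ≤ ((n : ℝ) + 1) ^ (3 / 2 : ℝ) * ‖j x‖ * ‖j y‖ := by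
  classical
  obtain ⟨η, -, rfl⟩ := (Finsupp.mem_span_image_iff_linearCombination ℂ).1 hy
  have hx' : x ∈ Submodule.span ℂ ((fun u : List I => wick s u.reverse) ''
      {v | v.length ≤ n}) := by
    refine Submodule.span_mono ?_ hx
    rintro _ ⟨v, hv, rfl⟩
    exact ⟨v.reverse, by simpa using hv, by simp⟩
  obtain ⟨ξ, hξ, rfl⟩ := (Finsupp.mem_span_image_iff_linearCombination ℂ).1 hx'
  rw [norm_map_linearCombination hj, norm_map_linearCombination_reverse hj]
  rw [Finsupp.mem_supported] at hξ
  have hmaps : ∀ u ∈ ξ.support, u.length ∈ Finset.range (n + 1) := fun u hu =>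
    Finset.mem_range_succ_iff.2 (hξ hu)
  have hsplit : ξ = ∑ p ∈ Finset.range (n + 1), ξ.filter fun u => u.length = p := by
    ext u
    rw [Finsupp.finsetSum_apply]
    simp only [Finsupp.filter_apply]
    rw [Finset.sum_ite_eq]
    split_ifs with h
    · rfl
    · exact Finsupp.notMem_support_iff.1 fun hu => h (hmaps u hu)
  have hnorm : ∑ p ∈ Finset.range (n + 1), normSqSum (ξ.filter fun u => u.length = p) =
      normSqSum ξ := by
    simp only [normSqSum, Finsupp.sum]
    rw [← Finset.sum_fiberwise_of_maps_to hmaps]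
    refine Finset.sum_congr rfl fun p _ => ?_
    rw [Finsupp.support_filter]
    refine Finset.sum_congr rfl fun u hu => ?_
    rw [Finsupp.filter_apply, if_pos (Finset.mem_filter.1 hu).2]
  -- Each of the `n + 1` terms is at most `(n + 1) ^ 2`; this is the source of the exponent `3 / 2`.
  have hcube : √(∑ p ∈ Finset.range (n + 1), ((p : ℝ) + 1) ^ 2) ≤ ((n : ℝ) + 1) ^ (3 / 2 : ℝ) := by
    have h1 : ((n : ℝ) + 1) ^ (3 / 2 : ℝ) = √(((n : ℝ) + 1) ^ 3) := by
      rw [Real.sqrt_eq_rpow, ← Real.rpow_natCast, ← Real.rpow_mul (by positivity)]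
      norm_num
    rw [h1]
    refine Real.sqrt_le_sqrt ((Finset.sum_le_card_nsmul _ _ (((n : ℝ) + 1) ^ 2) fun p hp => ?_).trans ?_)
    · have : (p : ℝ) ≤ n := by exact_mod_cast Finset.mem_range_succ_iff.1 hp
      gcongr
    · rw [Finset.card_range, nsmul_eq_mul]
      push_cast
      exact le_of_eq (by ring)
  conv_lhs => rw [hsplit]
  rw [map_sum, Finset.sum_mul, map_sum]
  calc _ ≤ ∑ p ∈ Finset.range (n + 1), ((p : ℝ) + 1) *
        (√(normSqSum (ξ.filter fun u => u.length = p)) * √(normSqSum η)) :=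
        (norm_sum_le _ _).trans (Finset.sum_le_sum fun p _ =>
          norm_map_mul_le_of_homogeneous hj p _ η fun u hu => by
            rw [Finsupp.support_filter] at hu
            exact (Finset.mem_filter.1 hu).2)
    _ = (∑ p ∈ Finset.range (n + 1), √(((p : ℝ) + 1) ^ 2) *
        √(normSqSum (ξ.filter fun u => u.length = p))) * √(normSqSum η) := by
        rw [Finset.sum_mul]
        refine Finset.sum_congr rfl fun p _ => ?_
        rw [Real.sqrt_sq (by positivity), mul_assoc]
    _ ≤ _ := by
        gcongr
        -- Cauchy–Schwarz over the degree `p`.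
        refine (Real.sum_sqrt_mul_sqrt_le _ (fun _ => sq_nonneg _)
          fun _ => normSqSum_nonneg _).trans ?_
        rw [hnorm]
        gcongr

end Haagerup

/-! ### Semicircle law, freeness and orthonormality of Wick words. -/

section Semicircle

open Polynomial Real

/-- The Chebyshev polynomials of the second kind are centered for the semicircle law. -/
theorem integral_chebyshevS_mul_sqrt {k : ℕ} (hk : k ≠ 0) :
    ∫ t in (-2 : ℝ)..2, (Chebyshev.S ℝ k).eval t * √(4 - t ^ 2) = 0 := by
  -- The substitution `t = 2 cos θ` turns the integrand into a multiple of `sin ((k + 1) θ) sin θ`,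
  -- a difference of cosines with nonzero frequencies because `k ≠ 0`.
  have h := intervalIntegral.integral_comp_mul_deriv (a := 0) (b := π)
    (f := fun θ => 2 * cos θ) (f' := fun θ => 2 * -sin θ)
    (g := fun t => (Chebyshev.S ℝ k).eval t * √(4 - t ^ 2))
    (fun x _ => (hasDerivAt_cos x).const_mul 2) (by fun_prop) (by fun_prop)
  simp only [cos_zero, cos_pi, mul_one, mul_neg] at h
  rw [intervalIntegral.integral_symm, ← h, neg_eq_zero]
  have h2 : ∫ θ in (0 : ℝ)..π, 2 * (cos ((k + 2) * θ) - cos (k * θ)) = 0 := by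
    rw [intervalIntegral.integral_const_mul, intervalIntegral.integral_sub
      (Continuous.intervalIntegrable (by fun_prop) _ _)
      (Continuous.intervalIntegrable (by fun_prop) _ _),
      intervalIntegral.integral_comp_mul_left (fun x => cos x) (by positivity),
      intervalIntegral.integral_comp_mul_left (fun x => cos x) (by positivity)]
    have e1 := sin_nat_mul_pi k
    have e2 := sin_nat_mul_pi (k + 2)
    push_cast at e2
    simp [e1, e2]
  refine (intervalIntegral.integral_congr fun θ hθ => ?_).trans h2
  rw [Set.uIcc_of_le pi_pos.le] at hθ
  have hs : 0 ≤ sin θ := sin_nonneg_of_mem_Icc hθ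
  have e : √(4 - (2 * cos θ) ^ 2) = 2 * sin θ := by
    rw [show 4 - (2 * cos θ) ^ 2 = (2 * sin θ) ^ 2 by nlinarith [sin_sq_add_cos_sq θ]]
    exact sqrt_sq (by linarith)
  have e3 := Chebyshev.S_two_mul_real_cos θ k
  have e4 : cos ((k + 2) * θ) - cos (k * θ) = - 2 * (sin ((k + 1) * θ) * sin θ) := by
    rw [show ((k : ℝ) + 2) * θ = (k + 1) * θ + θ by ring, show (k : ℝ) * θ = (k + 1) * θ - θ by ring,
      cos_add, cos_sub]
    ring
  push_cast at e3
  simp only [Function.comp_apply, e, e4, ← e3]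
  ring

variable {A I : Type*} [Ring A] [StarRing A] [Algebra ℂ A] [StarModule ℂ A] {φ : A →ₗ[ℂ] ℂ}
  {s : I → A}

theorem IsFreeSemicircularSystem.map_aeval (hs : IsFreeSemicircularSystem φ s) (i : I)
    (p : ℝ[X]) : φ (aeval (s i) (p.map Complex.ofRealHom)) =
      ((1 / (2 * π) * ∫ t in (-2 : ℝ)..2, p.eval t * √(4 - t ^ 2) : ℝ) : ℂ) := by
  induction p using Polynomial.induction_on' with
  | add p q hp hq =>
    simp only [Polynomial.map_add, map_add, hp, hq, eval_add, add_mul]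
    rw [intervalIntegral.integral_add (Continuous.intervalIntegrable (by fun_prop) _ _)
      (Continuous.intervalIntegrable (by fun_prop) _ _)]
    push_cast
    ring
  | monomial n a =>
    rw [map_monomial, aeval_monomial, ← Algebra.smul_def, map_smul, hs.moments, semicircleMoment]
    simp only [eval_monomial, mul_assoc, intervalIntegral.integral_const_mul]
    simp
    ring

theorem IsFreeSemicircularSystem.map_chebyshevS (hs : IsFreeSemicircularSystem φ s) (i : I)
    {k : ℕ} (hk : k ≠ 0) : φ (aeval (s i) (Chebyshev.S ℂ k)) = 0 := by
  rw [← Chebyshev.map_S Complex.ofRealHom, hs.map_aeval, integral_chebyshevS_mul_sqrt hk]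
  simp

theorem exists_replicate_append (i : I) (w : List I) :
    ∃ (k : ℕ) (w' : List I), i :: w = List.replicate (k + 1) i ++ w' ∧ ∀ j ∈ w'.head?, i ≠ j := by
  induction w with
  | nil => exact ⟨0, [], by simp⟩
  | cons j w ih =>
    by_cases h : i = j
    · subst h
      obtain ⟨k, w', h1, h2⟩ := ih
      exact ⟨k + 1, w', by rw [h1]; rfl, h2⟩
    · exact ⟨0, j :: w, by simpa using h⟩

/-- Free Wick words are alternating products of centered elements. -/
theorem IsFreeSemicircularSystem.exists_alternating (hs : IsFreeSemicircularSystem φ s)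
    (n : ℕ) (w : List I) (hw : w.length ≤ n) :
    ∃ L : List (I × A), L.IsChain (fun p q => p.1 ≠ q.1) ∧ L.head?.map Prod.fst = w.head? ∧
      (∀ p ∈ L, p.2 ∈ StarAlgebra.adjoin ℂ {s p.1} ∧ φ p.2 = 0) ∧
      wick s w = (L.map Prod.snd).prod := by
  induction n generalizing w with
  | zero =>
    obtain rfl : w = [] := by simpa using hw
    exact ⟨[], by simp⟩
  | succ n ih =>
    cases w with
    | nil => exact ⟨[], by simp⟩
    | cons i w =>
      obtain ⟨k, w', h1, h2⟩ := exists_replicate_append i w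
      have hlen := congrArg List.length h1
      simp only [List.length_append, List.length_replicate, List.length_cons] at hlen hw
      obtain ⟨L, hc, hh, hp, he⟩ := ih w' (by omega)
      refine ⟨(i, aeval (s i) (Chebyshev.S ℂ (k + 1 : ℕ))) :: L, ?_, by simp, ?_, ?_⟩
      · rw [List.isChain_cons]
        refine ⟨fun p hpL => ?_, hc⟩
        refine h2 _ ?_
        -- The clause on heads is carried through the induction so that the new block is known to
        -- differ from the next one.
        rw [← hh]
        exact Option.mem_map_of_mem _ hpL
      · rintro p hpL
        rcases List.mem_cons.1 hpL with rfl | hpL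
        · refine ⟨?_, hs.map_chebyshevS i (Nat.succ_ne_zero k)⟩
          exact (Algebra.adjoin_le (S := (StarAlgebra.adjoin ℂ {s i}).toSubalgebra) (by simp))
            (aeval_mem_adjoin_singleton ℂ (s i))
        · exact hp p hpL
      · rw [h1, wick_replicate_append s h2, he]
        simp

theorem IsFreeFamily.map_prod_eq_zero (hs : IsFreeFamily φ s) {L : List (I × A)} (h0 : L ≠ [])
    (hc : L.IsChain (fun p q => p.1 ≠ q.1))
    (hL : ∀ p ∈ L, p.2 ∈ StarAlgebra.adjoin ℂ {s p.1} ∧ φ p.2 = 0) :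
    φ (L.map Prod.snd).prod = 0 := by
  obtain ⟨k, f, rfl⟩ : ∃ (k : ℕ) (f : Fin (k + 1) → I × A), L = List.ofFn f := by
    obtain ⟨k, hk⟩ := Nat.exists_eq_succ_of_ne_zero (mt List.length_eq_zero_iff.1 h0)
    refine ⟨k, fun j => L.get (j.cast hk.symm), ?_⟩
    refine List.ext_get (by simp [hk]) fun m h1 h2 => by simp [-List.ofFn_succ]
  rw [List.map_ofFn]
  refine hs k (fun j => (f j).1) _ (fun j => ?_) (fun j => ?_) fun j => ?_
  · rw [List.isChain_iff_getElem] at hc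
    have := hc j (by simp)
    simp only [List.getElem_ofFn] at this
    exact this
  · exact (hL _ (List.mem_ofFn.2 ⟨j, rfl⟩)).1
  · exact (hL _ (List.mem_ofFn.2 ⟨j, rfl⟩)).2

/-- Nontrivial free Wick words are centered. -/
theorem IsFreeSemicircularSystem.map_wick (hs : IsFreeSemicircularSystem φ s) {w : List I}
    (hw : w ≠ []) : φ (wick s w) = 0 := by
  obtain ⟨L, hc, hh, hp, he⟩ := hs.exists_alternating _ w le_rfl
  rw [he]
  refine hs.free.map_prod_eq_zero ?_ hc hp
  rintro rfl
  simp [eq_comm, hw] at hh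

/-- Free Wick words are orthonormal. -/
theorem IsFreeSemicircularSystem.map_star_wick_mul_wick [DecidableEq I]
    (hφ : φ 1 = 1) (hs : IsFreeSemicircularSystem φ s) (v w : List I) :
    φ (star (wick s v) * wick s w) = if v = w then 1 else 0 := by
  rw [star_wick s hs.selfAdjoint]
  induction v generalizing w with
  | nil =>
    cases w with
    | nil => simp [hφ]
    | cons j w => simp [hs.map_wick]
  | cons i v ih =>
    rw [List.reverse_cons]
    -- Without annihilation a nonempty, hence centered, word remains; otherwise its centered part
    -- drops out and both words lose a letter.
    by_cases h : ∀ j ∈ w.head?, i ≠ j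
    · rw [wick_append_singleton_mul_of_head s h, hs.map_wick (by simp), if_neg]
      rintro rfl
      exact h i (by simp) rfl
    · cases w with
      | nil => simp at h
      | cons j w =>
        obtain rfl : i = j := by simpa using h
        rw [wick_append_singleton_mul_cons_self, map_add, hs.map_wick (by simp), ih]
        simp

end Semicircle

/-! ### States on C⋆-algebras and norms from moments. -/

section CStar

variable {B : Type*} [CStarAlgebra B] {φ : B →ₗ[ℂ] ℂ}

theorem abs_le_norm_of_mem_spectrum {a : B} {t : ℝ} (ht : t ∈ spectrum ℝ a) : |t| ≤ ‖a‖ := by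
  cases subsingleton_or_nontrivial B
  · simp [spectrum.of_subsingleton] at ht
  · exact spectrum.norm_le_norm_of_mem ht

/-- A state is nonnegative on functions of `a` that are nonnegative on the spectrum of `a`. -/
theorem IsState.re_cfc_nonneg (hφ : IsState φ) (a : B) {f : ℝ → ℝ}
    (hf : ContinuousOn f (spectrum ℝ a)) (h0 : ∀ t ∈ spectrum ℝ a, 0 ≤ f t) :
    0 ≤ (φ (cfc f a)).re := by
  have hg : ContinuousOn (fun t => Real.sqrt (f t)) (spectrum ℝ a) := hf.sqrt
  have hsa : IsSelfAdjoint (cfc (fun t => Real.sqrt (f t)) a) := cfc_predicate _ a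
  have h : cfc f a = star (cfc (fun t => Real.sqrt (f t)) a) * cfc (fun t => Real.sqrt (f t)) a := by
    rw [hsa.star_eq, ← cfc_mul _ _ a hg hg]
    exact cfc_congr fun t ht => (Real.mul_self_sqrt (h0 t ht)).symm
  rw [h]
  exact (Complex.nonneg_iff.1 (hφ.nonneg _)).1

theorem IsState.normTwo_le_norm (hφ : IsState φ) (x : B) : normTwo φ x ≤ ‖x‖ := by
  have hsa : IsSelfAdjoint (star x * x) := IsSelfAdjoint.star_mul_self x
  have h := hφ.re_cfc_nonneg (star x * x) (f := fun t => ‖x‖ ^ 2 - t) (by fun_prop) fun t ht => by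
    have h1 := abs_le_norm_of_mem_spectrum ht
    rw [CStarRing.norm_star_mul_self] at h1
    have := le_abs_self t
    nlinarith
  rw [cfc_sub (fun _ => ‖x‖ ^ 2) (fun t => t) (star x * x) (by fun_prop) (by fun_prop),
    cfc_const _ _ hsa, cfc_id' ℝ (star x * x) hsa, map_sub,
    IsScalarTower.algebraMap_apply ℝ ℂ B, Algebra.algebraMap_eq_smul_one, map_smul, hφ.map_one] at h
  rw [normTwo]
  refine Real.sqrt_le_iff.2 ⟨norm_nonneg _, ?_⟩
  have : ((algebraMap ℝ ℂ) (‖x‖ ^ 2) • (1 : ℂ)).re = ‖x‖ ^ 2 := by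
    rw [smul_eq_mul, mul_one]
    exact Complex.ofReal_re _
  rw [Complex.sub_re, this] at h
  linarith

/-- The norm of a self-adjoint element is controlled by the growth of its even moments in a
faithful state. -/
theorem IsState.norm_le_of_moments_le (hφ : IsState φ) (hf : ∀ a, φ (star a * a) = 0 → a = 0)
    {a : B} (ha : IsSelfAdjoint a) {K : ℝ} (hK : 0 ≤ K)
    (h : ∀ m : ℕ, (φ (a ^ (2 * m))).re ≤ K ^ (2 * m)) : ‖a‖ ≤ K := by
  by_contra! hlt
  obtain ⟨c, hKc, hca⟩ := exists_between hlt
  have hc : 0 < c := hK.trans_lt hKc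
  -- `f` vanishes exactly on `[-c, c]`, so `cfc f a = 0` confines the spectrum there and contradicts
  -- `c < ‖a‖`.
  let f : ℝ → ℝ := fun t => max (|t| - c) 0
  have hfc : Continuous f := by fun_prop
  have hbsa : IsSelfAdjoint (cfc f a) := cfc_predicate _ a
  have hsq : star (cfc f a) * cfc f a = cfc (fun t => f t ^ 2) a := by
    rw [hbsa.star_eq, ← cfc_mul _ _ a hfc.continuousOn hfc.continuousOn]
    simp only [sq]
  have hnn := Complex.nonneg_iff.1 (hφ.nonneg (cfc f a))
  -- A Markov-type estimate: `c ^ (2m) f(t)² ≤ ‖a‖² t ^ (2m)` on the spectrum.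
  have hbound : ∀ m : ℕ, c ^ (2 * m) * (φ (star (cfc f a) * cfc f a)).re ≤
      ‖a‖ ^ 2 * K ^ (2 * m) := fun m => by
    have h1 := hφ.re_cfc_nonneg a
      (f := fun t => ‖a‖ ^ 2 * t ^ (2 * m) - c ^ (2 * m) * f t ^ 2) (by fun_prop) fun t ht => by
      have h1 := abs_le_norm_of_mem_spectrum ht
      have hev : t ^ (2 * m) = |t| ^ (2 * m) := by rw [pow_mul, pow_mul, sq_abs]
      rw [hev, sub_nonneg, mul_comm]
      rcases le_total (|t|) c with h2 | h2
      · have : f t = 0 := max_eq_right (by linarith)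
        rw [this]
        simp only [ne_eq, OfNat.ofNat_ne_zero, not_false_eq_true, zero_pow, zero_mul]
        positivity
      · have : f t = |t| - c := max_eq_left (by linarith)
        rw [this]
        have h3 : c ^ (2 * m) ≤ |t| ^ (2 * m) := pow_le_pow_left₀ hc.le h2 _
        have h4 : (|t| - c) ^ 2 ≤ ‖a‖ ^ 2 :=
          pow_le_pow_left₀ (by linarith) (by linarith) _
        exact mul_le_mul h4 h3 (by positivity) (by positivity)
    have e1 : cfc (fun t => ‖a‖ ^ 2 * t ^ (2 * m) - c ^ (2 * m) * f t ^ 2) a =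
        ((‖a‖ ^ 2 : ℝ) : ℂ) • a ^ (2 * m) - ((c ^ (2 * m) : ℝ) : ℂ) • cfc (fun t => f t ^ 2) a := by
      rw [cfc_sub _ _ a (by fun_prop) (by fun_prop), cfc_const_mul _ _ a (by fun_prop),
        cfc_const_mul _ _ a (by fun_prop), cfc_pow_id a (2 * m) ha, Complex.coe_smul,
        Complex.coe_smul]
    rw [e1, ← hsq, map_sub, map_smul, map_smul, smul_eq_mul, smul_eq_mul, Complex.sub_re,
      Complex.re_ofReal_mul, Complex.re_ofReal_mul] at h1
    have := mul_le_mul_of_nonneg_left (h m) (sq_nonneg ‖a‖)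
    linarith
  have hzero : (φ (star (cfc f a) * cfc f a)).re ≤ 0 := by
    -- Dividing by `c ^ (2m)` leaves a bound that tends to zero because `K < c`.
    have hlim : Filter.Tendsto (fun m : ℕ => ‖a‖ ^ 2 * ((K / c) ^ 2) ^ m) Filter.atTop
        (nhds (‖a‖ ^ 2 * 0)) := by
      refine (tendsto_pow_atTop_nhds_zero_of_lt_one (by positivity) ?_).const_mul _
      have : K / c < 1 := (div_lt_one hc).2 hKc
      have : 0 ≤ K / c := by positivity
      nlinarith
    rw [mul_zero] at hlim
    refine ge_of_tendsto' hlim fun m => ?_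
    have := hbound m
    rw [← pow_mul, div_pow, mul_div_assoc', le_div_iff₀ (by positivity)]
    linarith
  have hb0 : cfc f a = 0 := by
    apply hf
    apply Complex.ext
    · exact le_antisymm hzero hnn.1
    · exact hnn.2.symm
  have hna : ‖a‖ ≤ c := by
    have : a = cfc (fun t : ℝ => t) a := (cfc_id' ℝ a ha).symm
    rw [this]
    refine norm_cfc_le hc.le fun t ht => ?_
    have h1 : f t = 0 := by
      have h2 := cfc_map_spectrum f a ha hfc.continuousOn
      have h3 : f t ∈ spectrum ℝ (cfc f a) := h2 ▸ Set.mem_image_of_mem f ht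
      rw [hb0] at h3
      have : Nontrivial B := ⟨⟨a, 0, fun e => by simp [e] at hlt; linarith⟩⟩
      simpa using h3
    have := le_max_left (|t| - c) 0
    rw [Real.norm_eq_abs]
    have h5 : max (|t| - c) 0 = 0 := h1
    linarith
  linarith

end CStar

/-! ### From the `L²` bound to the operator norm. -/

section Main

variable {A : Type*} [Ring A] [StarRing A] [Algebra ℂ A] {φ : A →ₗ[ℂ] ℂ}

theorem normTwo_star (htr : ∀ a b, φ (a * b) = φ (b * a)) (x : A) :
    normTwo φ (star x) = normTwo φ x := by
  rw [normTwo, normTwo, star_star, htr]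

theorem IsState.normTwo_sq (hφ : IsState φ) (x : A) :
    normTwo φ x ^ 2 = (φ (star x * x)).re :=
  Real.sq_sqrt (Complex.nonneg_iff.1 (hφ.nonneg x)).1

variable [StarModule ℂ A]

/-- Polarization: `φ (star z * z)` is real for `z = x + y` and for `z = x + i y`. -/
theorem IsState.conj_map_star_mul (hφ : IsState φ) (x y : A) :
    (starRingEnd ℂ) (φ (star y * x)) = φ (star x * y) := by
  have h1 := (Complex.nonneg_iff.1 (hφ.nonneg (x + y))).2
  have h2 := (Complex.nonneg_iff.1 (hφ.nonneg (x + Complex.I • y))).2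
  have hx := (Complex.nonneg_iff.1 (hφ.nonneg x)).2
  have hy := (Complex.nonneg_iff.1 (hφ.nonneg y)).2
  simp only [star_add, star_smul, add_mul, mul_add, smul_mul_assoc, mul_smul_comm, map_add,
    map_smul, smul_eq_mul, Complex.add_im, Complex.mul_im, Complex.mul_re, RCLike.star_def, Complex.conj_I,
    Complex.neg_re, Complex.neg_im, Complex.I_re, Complex.I_im] at h1 h2
  apply Complex.ext
  · rw [Complex.conj_re]
    linarith
  · rw [Complex.conj_im]
    linarith

/-- The pre-Hilbert space attached to a state. -/
theorem IsState.exists_inner.{u} {A : Type u} [Ring A] [StarRing A] [Algebra ℂ A]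
    [StarModule ℂ A] {φ : A →ₗ[ℂ] ℂ} (hφ : IsState φ) :
    ∃ (E : Type u) (_ : SeminormedAddCommGroup E) (_ : InnerProductSpace ℂ E) (j : A →ₗ[ℂ] E),
      (∀ x y, inner ℂ (j x) (j y) = φ (star x * y)) ∧ ∀ x, ‖j x‖ = normTwo φ x := by
  let c : PreInnerProductSpace.Core ℂ A :=
    { inner := fun x y => φ (star x * y)
      conj_inner_symm := fun x y => hφ.conj_map_star_mul x y
      re_inner_nonneg := fun x => (Complex.nonneg_iff.1 (hφ.nonneg x)).1
      add_left := fun x y z => by simp [add_mul]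
      smul_left := fun x y r => by simp }
  let _ := @InnerProductSpace.Core.toSeminormedAddCommGroup ℂ A _ _ _ c
  let _ := InnerProductSpace.ofCore c
  -- A seminorm suffices, so neither quotient nor completion is taken.
  refine ⟨A, inferInstance, inferInstance, LinearMap.id, fun x y => rfl, fun x => rfl⟩

variable {I : Type*} {s : I → A}

theorem IsState.normTwo_mul_le (hφ : IsState φ) (hs : IsFreeSemicircularSystem φ s) {n m : ℕ}
    {x y : A} (hx : x ∈ wickSpan s n) (hy : y ∈ wickSpan s m) :
    normTwo φ (x * y) ≤ ((n : ℝ) + 1) ^ (3 / 2 : ℝ) * normTwo φ x * normTwo φ y := by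
  classical
  obtain ⟨E, _, _, j, hinner, hnorm⟩ := hφ.exists_inner
  have hj : Orthonormal ℂ fun v => j (wick s v) := by
    rw [orthonormal_iff_ite]
    intro v w
    rw [hinner, hs.map_star_wick_mul_wick hφ.map_one]
  simp only [← hnorm]
  exact norm_map_mul_le hj hx hy

theorem star_mem_wickSpan (hs : ∀ i, IsSelfAdjoint (s i)) {n : ℕ} {x : A}
    (hx : x ∈ wickSpan s n) : star x ∈ wickSpan s n := by
  induction hx using Submodule.span_induction with
  | zero => simp
  | add x y _ _ hx hy => rw [star_add]; exact add_mem hx hy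
  | smul c x _ hx => rw [star_smul]; exact Submodule.smul_mem _ _ hx
  | mem x hx =>
    obtain ⟨v, hv, rfl⟩ := hx
    rw [star_wick s hs]
    exact wick_mem_wickSpan (by simpa using hv)

theorem wick_mem_adjoin {A : Type*} [Ring A] [Algebra ℂ A] (s : I → A) (w : List I) :
    wick s w ∈ Algebra.adjoin ℂ (Set.range s) := by
  have h : ∀ i, s i ∈ Algebra.adjoin ℂ (Set.range s) := fun i =>
    Algebra.subset_adjoin (Set.mem_range_self i)
  induction w using List.twoStepInduction with
  | nil => simp
  | singleton i => simpa using h i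
  | cons_cons i j w ih1 ih2 =>
    rw [wick]
    refine sub_mem (mul_mem (h i) (ih2 j)) ?_
    split_ifs
    · exact ih1
    · exact zero_mem _

/-- The `L²` bound does not depend on the degree of the right factor, so it is enough that powers of
`star x * x` have some degree. -/
theorem mem_adjoin_iff_mem_wickSpan {A : Type*} [Ring A] [Algebra ℂ A] {s : I → A} {x : A} :
    x ∈ Algebra.adjoin ℂ (Set.range s) ↔ ∃ n, x ∈ wickSpan s n := by
  constructor
  · intro h
    rw [Algebra.adjoin_range_eq_range_freeAlgebra_lift] at h
    obtain ⟨P, rfl⟩ := h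
    exact ⟨_, lift_mem_wickSpan P⟩
  · rintro ⟨n, h⟩
    have : wickSpan s n ≤ Subalgebra.toSubmodule (Algebra.adjoin ℂ (Set.range s)) := by
      refine Submodule.span_le.2 ?_
      rintro _ ⟨v, -, rfl⟩
      exact wick_mem_adjoin s v
    exact this h

/-- Each further factor `star x * x` costs the constant twice; traciality makes it the same for
`star x` and `x`. -/
theorem IsState.normTwo_pow_le (hφ : IsState φ) (htr : ∀ a b, φ (a * b) = φ (b * a))
    (hs : IsFreeSemicircularSystem φ s) {n : ℕ} {x : A} (hx : x ∈ wickSpan s n) (m : ℕ) :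
    normTwo φ ((star x * x) ^ m) ≤
      ((((n : ℝ) + 1) ^ (3 / 2 : ℝ) * normTwo φ x) ^ 2) ^ m := by
  have hx' := star_mem_wickSpan hs.selfAdjoint hx
  have hxa := mem_adjoin_iff_mem_wickSpan.2 ⟨n, hx⟩
  have hxa' := mem_adjoin_iff_mem_wickSpan.2 ⟨n, hx'⟩
  induction m with
  | zero => simp [normTwo, hφ.map_one]
  | succ m ih =>
    have hpow := pow_mem (mul_mem hxa' hxa) m
    obtain ⟨k, hk⟩ := mem_adjoin_iff_mem_wickSpan.1 hpow
    obtain ⟨l, hl⟩ := mem_adjoin_iff_mem_wickSpan.1 (mul_mem hxa hpow)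
    have h1 := hφ.normTwo_mul_le hs hx hk
    have h2 := hφ.normTwo_mul_le hs hx' hl
    rw [normTwo_star htr] at h2
    have h0 : 0 ≤ normTwo φ x := Real.sqrt_nonneg _
    rw [pow_succ', pow_succ', mul_assoc]
    calc _ ≤ _ := h2
      _ ≤ ((n : ℝ) + 1) ^ (3 / 2 : ℝ) * normTwo φ x * (((n : ℝ) + 1) ^ (3 / 2 : ℝ) * normTwo φ x *
          ((((n : ℝ) + 1) ^ (3 / 2 : ℝ) * normTwo φ x) ^ 2) ^ m) := by
        gcongr
        exact h1.trans (by gcongr)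
      _ = _ := by ring

/-- Haagerup's inequality for a free semicircular system in a C⋆-algebra with a faithful tracial
state. -/
theorem IsState.norm_le_of_mem_wickSpan {B : Type*} [CStarAlgebra B] {φ : B →ₗ[ℂ] ℂ}
    (hφ : IsState φ) (htr : ∀ a b, φ (a * b) = φ (b * a))
    (hf : ∀ a, φ (star a * a) = 0 → a = 0) {s : I → B} (hs : IsFreeSemicircularSystem φ s)
    {n : ℕ} {x : B} (hx : x ∈ wickSpan s n) :
    ‖x‖ ≤ ((n : ℝ) + 1) ^ (3 / 2 : ℝ) * normTwo φ x := by
  have h0 : 0 ≤ normTwo φ x := Real.sqrt_nonneg _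
  have hsa := IsSelfAdjoint.star_mul_self x
  have h := hφ.norm_le_of_moments_le hf hsa
    (K := (((n : ℝ) + 1) ^ (3 / 2 : ℝ) * normTwo φ x) ^ 2) (by positivity) fun m => by
      -- The moment of order `2 * m` of `star x * x` is the squared `L²`-norm of its `m`-th power.
      have h1 := hφ.normTwo_sq ((star x * x) ^ m)
      rw [(hsa.pow m).star_eq, ← pow_add, ← two_mul] at h1
      rw [← h1, mul_comm 2 m, pow_mul _ m 2]
      have := hφ.normTwo_pow_le htr hs hx m
      have : 0 ≤ normTwo φ ((star x * x) ^ m) := Real.sqrt_nonneg _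
      gcongr
  rw [CStarRing.norm_star_mul_self, ← sq] at h
  exact (pow_le_pow_iff_left₀ (norm_nonneg _) (by positivity) two_ne_zero).1 h

/-- `M` is its own double commutant, and centralizers are closed; this makes `M` a C⋆-algebra, to
which the abstract inequality applies. -/
theorem isClosed_toStarSubalgebra {H : Type*} [NormedAddCommGroup H] [InnerProductSpace ℂ H]
    [CompleteSpace H] (M : VonNeumannAlgebra H) :
    IsClosed (M.toStarSubalgebra : Set (H →L[ℂ] H)) := by
  rw [VonNeumannAlgebra.coe_toStarSubalgebra, ← M.centralizer_centralizer]
  exact Set.isClosed_centralizer _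

end Main

end FreeProb

theorem mainTheorem6 {H : Type*} [NormedAddCommGroup H] [InnerProductSpace ℂ H] [CompleteSpace H]
    (M : VonNeumannAlgebra H) (τ : M.toStarSubalgebra →ₗ[ℂ] ℂ)
    (hτ : FreeProb.IsFaithfulNormalTracialState M τ)
    {I : Type*} (s : I → M.toStarSubalgebra) (hs : FreeProb.IsFreeSemicircularSystem τ s)
    (P : FreeAlgebra ℂ I) :
    FreeProb.normTwo τ (FreeAlgebra.lift ℂ s P) ≤
        ‖(FreeAlgebra.lift ℂ s P : H →L[ℂ] H)‖ ∧
      ‖(FreeAlgebra.lift ℂ s P : H →L[ℂ] H)‖ ≤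
        ((FreeProb.ncDegree P : ℝ) + 1) ^ (3 / 2 : ℝ) *
          FreeProb.normTwo τ (FreeAlgebra.lift ℂ s P) := by
  have : IsClosed (M.toStarSubalgebra : Set (H →L[ℂ] H)) := FreeProb.isClosed_toStarSubalgebra M
  exact ⟨hτ.toIsState.normTwo_le_norm _, hτ.toIsState.norm_le_of_mem_wickSpan hτ.tracial
    hτ.faithful hs (FreeProb.lift_mem_wickSpan P)⟩
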